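/- A stable matching instance consists of $n$ men and $n$ women, each of whom ranks all members of the opposite sex by a strict total order. In the $1$-attribute model every person $x$ has a preference $\hat x\in\mathbb R$ and a position $\bar x\in\mathbb R$, and $x$ prefers $y$ to $z$ if and only if $\hat x\,\bar y>\hat x\,\bar z$ (these preferences being strict total orders). A matching is a bijection between men and women; it is stable if no man and woman prefer each other to their spouses. Let $\mathcal M$ be a stable matching. The suitor $S_{\mathcal M}(M)$ of a man $M$ is the first woman $w$ on his list, if there is one, such that $M$ prefers his spouse to $w$ and $w$ prefers $M$ to her spouse. A rotation exposed in $\mathcal M$ is a non-empty list $R=\{(M_0,w_0),\dots,(M_{k-1},w_{k-1})\}$ of distinct pairs of $\mathcal M$ with $S_{\mathcal M}(M_i)=w_{i+1 \bmod k}$ for all $i$, taken up to cyclic shifts; $k$ is its size. The rotations of the instance are the rotations exposed in its stable matchings. $R$ moves $M_i$ from $w_i$ to $w_{i+1}$ and $w_{i+1}$ from $M_{i+1}$ to $M_i$ (indices modulo $k$). $R$ eliminates a pair $(M,w)$ if it moves $w$ from $M$, or from a man below $M$ on her list, to a man strictly above $M$. For distinct rotations $R,R'$, $R$ explicitly precedes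 $R'$ if $R$ eliminates a pair $(M,w)$ and $R'$ moves $M$ to a woman $w'$ such that $M$ strictly prefers $w$ to $w'$. The rotation poset is the set of rotations ordered by the reflexive and transitive closure of "explicitly precedes". Theorem. For every stable matching instance in the $1$-attribute model: (1) the rotation poset is a finite (possibly empty) chain: for some $k\ge 0$ it is order-isomorphic to a $k$-element totally ordered set, and its Hasse diagram, as a graph, is isomorphic to the path on $k$ vertices; (2) every rotation has size $2$; (3) every man and every woman takes part in at most one rotation; (4) for any two distinct rotations, one of them explicitly precedes the other. -/

import Mathlib

/-- An instance of the stable matching problem on a set `M` of men and a set `W` of women: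
every man ranks all women, and every woman ranks all men, by a strict total order. -/
structure SMInstance (M W : Type*) where
  /-- `manPrefers m w w'`: man `m` strictly prefers woman `w` to woman `w'`. -/
  manPrefers : M → W → W → Prop
  /-- `womanPrefers w m m'`: woman `w` strictly prefers man `m` to man `m'`. -/
  womanPrefers : W → M → M → Prop
  manPrefers_strictTotal : ∀ m, IsStrictTotalOrder W (manPrefers m)
  womanPrefers_strictTotal : ∀ w, IsStrictTotalOrder M (womanPrefers w)

namespace SMInstance

/-- The `k`-attribute model: every person has a preference vector and a position vector in `ℝ^k`,
and everybody ranks the persons of the opposite sex by the dot product of the own preference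
vector with their position vectors (larger is better). -/
def IsAttribute {M W : Type*} (k : ℕ) (I : SMInstance M W) : Prop :=
  ∃ (manPref manPos : M → Fin k → ℝ) (womanPref womanPos : W → Fin k → ℝ),
    (∀ m w w', I.manPrefers m w w' ↔ manPref m ⬝ᵥ womanPos w > manPref m ⬝ᵥ womanPos w') ∧
    (∀ w m m', I.womanPrefers w m m' ↔ womanPref w ⬝ᵥ manPos m > womanPref w ⬝ᵥ manPos m')

/-- A (perfect) matching is a bijection `μ` from men to women; it is stable if there is no
blocking pair, i.e. no man and woman who prefer each other to their spouses. -/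
def IsStable {M W : Type*} (I : SMInstance M W) (μ : M ≃ W) : Prop :=
  ¬ ∃ m w, I.manPrefers m w (μ m) ∧ I.womanPrefers w m (μ.symm w)

/-- `m` prefers his spouse to `w`, and `w` prefers `m` to her spouse. -/
def IsSuitorCandidate {M W : Type*} (I : SMInstance M W) (μ : M ≃ W) (m : M) (w : W) : Prop :=
  I.manPrefers m (μ m) w ∧ I.womanPrefers w m (μ.symm w)

/-- `w` is the suitor of `m` in `μ`: the first candidate on the preference list of `m`. -/
def IsSuitor {M W : Type*} (I : SMInstance M W) (μ : M ≃ W) (m : M) (w : W) : Prop :=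
  I.IsSuitorCandidate μ m w ∧
    ∀ w', I.IsSuitorCandidate μ m w' → w' = w ∨ I.manPrefers m w w'

/-- The list `(M₀, w₀), …, (Mₖ₋₁, wₖ₋₁)` of distinct pairs (taken up to cyclic shifts, `k ≥ 1`)
is exposed in `μ`: all its pairs belong to `μ`, and the suitor of `Mᵢ` is `wᵢ₊₁` (indices
modulo `k`). -/
def IsExposed {M W : Type*} (I : SMInstance M W) (μ : M ≃ W) (R : Cycle (M × W)) : Prop :=
  R ≠ Cycle.nil ∧ R.Nodup ∧ (∀ p ∈ R, μ p.1 = p.2) ∧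
    R.Chain (fun p q => I.IsSuitor μ p.1 q.2)

/-- The rotations of an instance: the cyclic lists of pairs exposed in some stable matching. -/
def Rotation {M W : Type*} (I : SMInstance M W) : Type _ :=
  {R : Cycle (M × W) // ∃ μ : M ≃ W, I.IsStable μ ∧ I.IsExposed μ R}

namespace Rotation

theorem nodup {M W : Type*} {I : SMInstance M W} (R : I.Rotation) : R.1.Nodup := by
  obtain ⟨_, _, h⟩ := R.2
  exact h.2.1

/-- The number of pairs of a rotation. -/
def size {M W : Type*} {I : SMInstance M W} (R : I.Rotation) : ℕ := R.1.length

/-- Man `m` takes part in the rotation `R`. -/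
def HasMan {M W : Type*} {I : SMInstance M W} (R : I.Rotation) (m : M) : Prop :=
  ∃ w, (m, w) ∈ R.1

/-- Woman `w` takes part in the rotation `R`. -/
def HasWoman {M W : Type*} {I : SMInstance M W} (R : I.Rotation) (w : W) : Prop :=
  ∃ m, (m, w) ∈ R.1

/-- The pair `q` comes cyclically right after the pair `p` in `R`. -/
def IsNext {M W : Type*} [DecidableEq M] [DecidableEq W] {I : SMInstance M W}
    (R : I.Rotation) (p q : M × W) : Prop :=
  ∃ hp : p ∈ R.1, R.1.next R.nodup p hp = q

/-- `R` moves man `m` to woman `w`: `m = Mᵢ` and `w = wᵢ₊₁` for some `i`. -/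
def MovesManTo {M W : Type*} [DecidableEq M] [DecidableEq W] {I : SMInstance M W}
    (R : I.Rotation) (m : M) (w : W) : Prop :=
  ∃ p q, R.IsNext p q ∧ p.1 = m ∧ q.2 = w

/-- `R` moves woman `w` from man `m` to man `m'`: `w = wᵢ₊₁`, `m = Mᵢ₊₁` and `m' = Mᵢ` for
some `i`. -/
def MovesWoman {M W : Type*} [DecidableEq M] [DecidableEq W] {I : SMInstance M W}
    (R : I.Rotation) (w : W) (m m' : M) : Prop :=
  ∃ p q, R.IsNext p q ∧ q = (m, w) ∧ p.1 = m'

/-- `R` eliminates the pair `(m, w)`: it moves `w` from `m`, or from a man below `m` on her list,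
to a man strictly above `m`. -/
def Eliminates {M W : Type*} [DecidableEq M] [DecidableEq W] {I : SMInstance M W}
    (R : I.Rotation) (m : M) (w : W) : Prop :=
  ∃ m₀ m₁, R.MovesWoman w m₀ m₁ ∧ (m₀ = m ∨ I.womanPrefers w m m₀) ∧ I.womanPrefers w m₁ m

/-- `R` explicitly precedes `R'`: they are distinct, `R` eliminates a pair `(m, w)`, and `R'`
moves `m` to a woman `w'` such that `m` prefers `w` to `w'`. -/
def ExplicitlyPrecedes {M W : Type*} [DecidableEq M] [DecidableEq W] {I : SMInstance M W}
    (R R' : I.Rotation) : Prop :=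
  R ≠ R' ∧ ∃ m w w', R.Eliminates m w ∧ R'.MovesManTo m w' ∧ I.manPrefers m w w'

/-- The order of the rotation poset: the reflexive and transitive closure of "explicitly
precedes". (Antisymmetry is not built into this instance.) -/
instance {M W : Type*} [DecidableEq M] [DecidableEq W] (I : SMInstance M W) :
    Preorder I.Rotation where
  le := Relation.ReflTransGen ExplicitlyPrecedes
  le_refl _ := Relation.ReflTransGen.refl
  le_trans _ _ _ := Relation.ReflTransGen.trans

end Rotation

end SMInstance

/-!
In the 1-attribute model every person ranks the other side either by the common scale of positions
or by its reverse, so men and women split into those who like high positions and those who like low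
ones (`IsTwoSided`).

Consider a stable matching. Call `m → m'` a candidate edge if the wife of `m'` prefers `m` to `m'`;
stability then makes `m` prefer his own wife to that of `m'`, and the suitor of `m` is the best wife
at the end of such an edge. Between two women of the same taste the edges follow a linear order, so
a rotation has to pass between women of opposite taste; there the edge is bidirectional, and
stability forces the suitor relation to be symmetric (`IsSuitor.eq_of_opposite`). Hence a rotation
consists of two couples, with men of opposite taste and women of opposite taste
(`IsExposed.exists_eq_pair`).

Stability also determines the matching from the number of its couples in which both persons like
high positions: each of the four classes of couples is cut out of its men, and of its women, by a
threshold. The four persons of a rotation sit at these thresholds, so their four ranks are tied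
together (`IsExposed.exists_isSwap`). Comparing ranks, the men of two distinct rotations span
strictly nested intervals, and so do the women, in the opposite order (`Rotation.nested_or`); in
particular distinct rotations share no person. A rotation eliminates only pairs whose man lies in
the interval of its men, and therefore explicit precedence holds exactly from the outer to the inner
rotation. It is a strict linear order, which gives the chain.
-/

namespace SMInstance

variable {M W : Type*}

/-! ### Preferences from two scales -/

/-- The preferences of `I` are read off from two scales: `q` places the men and `p` places the
women on the real line; the men with `s m` and the women with `t w` like high positions, all other
persons like low positions. -/
structure IsTwoSided (I : SMInstance M W) (s : M → Prop) (t : W → Prop) (q : M → ℝ) (p : W → ℝ) :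
    Prop where
  q_inj : Function.Injective q
  p_inj : Function.Injective p
  man : ∀ m w w', I.manPrefers m w w' ↔ (s m ∧ p w' < p w) ∨ (¬ s m ∧ p w < p w')
  woman : ∀ w m m', I.womanPrefers w m m' ↔ (t w ∧ q m' < q m) ∨ (¬ t w ∧ q m < q m')

/-- A strict total order given by comparing `c * f x` comes from an order by `f` or its reverse. -/
theorem scale_iff {X : Type*} {r : X → X → Prop} [IsStrictTotalOrder X r] {c : ℝ} {f : X → ℝ}
    (h : ∀ x y, r x y ↔ c * f x > c * f y) (x y : X) :
    r x y ↔ (0 < c ∧ f y < f x) ∨ (¬ 0 < c ∧ f x < f y) := by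
  rw [h]
  by_cases hxy : x = y
  · subst hxy; simp
  have hc : c ≠ 0 := by
    rintro rfl
    rcases trichotomous_of r x y with h' | h' | h'
    · simp [h] at h'
    · exact hxy h'
    · simp [h] at h'
  rcases lt_or_gt_of_ne hc with hc | hc
  · simp [hc.not_gt, hc, mul_lt_mul_left_of_neg]
  · simp [hc]

theorem scale_injective {X : Type*} {r : X → X → Prop} [IsStrictTotalOrder X r] {c : ℝ}
    {f : X → ℝ} (h : ∀ x y, r x y ↔ c * f x > c * f y) : Function.Injective f := by
  intro x y hxy
  rcases trichotomous_of r x y with h' | h' | h'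
  · simp [h, hxy] at h'
  · exact h'
  · simp [h, hxy] at h'

theorem IsAttribute.exists_isTwoSided [Fintype M] [Fintype W]
    (hcard : Fintype.card M = Fintype.card W) {I : SMInstance M W} (hI : I.IsAttribute 1) :
    ∃ s t q p, I.IsTwoSided s t q p := by
  obtain ⟨a, q, b, p, hm, hw⟩ := hI
  simp only [dotProduct, Finset.univ_unique, Finset.sum_singleton] at hm hw
  have := I.manPrefers_strictTotal
  have := I.womanPrefers_strictTotal
  refine ⟨fun m => 0 < a m default, fun w => 0 < b w default, fun m => q m default,
    fun w => p w default, fun m m' h => ?_, fun w w' h => ?_, fun m => scale_iff (hm m),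
    fun w => scale_iff (hw w)⟩
  · have : Nonempty W := Fintype.card_pos_iff.1 (hcard ▸ Fintype.card_pos_iff.2 ⟨m⟩)
    exact scale_injective (hw (Classical.arbitrary W)) h
  · have : Nonempty M := Fintype.card_pos_iff.1 (hcard ▸ Fintype.card_pos_iff.2 ⟨w⟩)
    exact scale_injective (hm (Classical.arbitrary M)) h

/-! ### The shape of a rotation -/

theorem cycle_chain_and_mem {α : Type*} {r : α → α → Prop} {c : Cycle α} (h : c.Chain r) :
    c.Chain (fun a b => r a b ∧ a ∈ c ∧ b ∈ c) := by
  induction c using Cycle.induction_on with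
  | nil => trivial
  | cons a l _ =>
    rw [Cycle.chain_coe_cons] at h ⊢
    refine List.IsChain.imp_of_mem_imp (fun x y hx hy hxy => ⟨hxy, ?_, ?_⟩) h
    · have : x = a ∨ x ∈ l ∨ x = a := by simpa using hx
      simpa using by tauto
    · have : y = a ∨ y ∈ l ∨ y = a := by simpa using hy
      simpa using by tauto

theorem exists_cons_of_mem_cycle {α : Type*} {c : Cycle α} {a : α} (h : a ∈ c) :
    ∃ l : List α, c = ↑(a :: l) := by
  induction c using Quotient.inductionOn' with
  | h l =>
    obtain ⟨l₁, l₂, rfl⟩ := List.append_of_mem (show a ∈ l from h)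
    exact ⟨l₂ ++ l₁, Cycle.coe_eq_coe.2 (List.isRotated_append (l := l₁) (l' := a :: l₂))⟩

section Stable

variable {I : SMInstance M W} {s : M → Prop} {t : W → Prop} {q : M → ℝ} {p : W → ℝ} {μ : M ≃ W}

theorem IsStable.not_blocking (hS : I.IsTwoSided s t q p) (hμ : I.IsStable μ) (m m' : M) :
    ¬ (((s m ∧ p (μ m) < p (μ m')) ∨ (¬ s m ∧ p (μ m') < p (μ m))) ∧
      ((t (μ m') ∧ q m' < q m) ∨ (¬ t (μ m') ∧ q m < q m'))) := by
  rw [← hS.man, ← hS.woman]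
  intro h
  exact hμ ⟨m, μ m', by simpa using h⟩

theorem IsSuitor.spec (hS : I.IsTwoSided s t q p) {m m' : M}
    (h : I.IsSuitor μ m (μ m')) :
    ((s m ∧ p (μ m') < p (μ m)) ∨ (¬ s m ∧ p (μ m) < p (μ m'))) ∧
      ((t (μ m') ∧ q m' < q m) ∨ (¬ t (μ m') ∧ q m < q m')) := by
  have := h.1
  simpa [IsSuitorCandidate, hS.man, hS.woman] using this

/-- Stability makes every woman `μ x` who prefers `m` to `x` a candidate, so that the suitor of `m`
is the best of all such women. -/
theorem IsSuitor.best (hS : I.IsTwoSided s t q p) (hμ : I.IsStable μ) {m m' : M}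
    (h : I.IsSuitor μ m (μ m')) (x : M)
    (hx : (t (μ x) ∧ q x < q m) ∨ (¬ t (μ x) ∧ q m < q x)) :
    x = m' ∨ (s m ∧ p (μ x) < p (μ m')) ∨ (¬ s m ∧ p (μ m') < p (μ x)) := by
  have h2 := h.2 (μ x)
  have h3 := hμ.not_blocking hS m x
  have hxm : x ≠ m := by rintro rfl; simp at hx
  have hne : p (μ x) ≠ p (μ m) := fun h => hxm (μ.injective (hS.p_inj h))
  simp only [IsSuitorCandidate, hS.man, hS.woman, Equiv.symm_apply_apply,
    μ.injective.eq_iff] at h2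
  grind

theorem IsSuitor.unique (hS : I.IsTwoSided s t q p) (hμ : I.IsStable μ) {m a b : M}
    (ha : I.IsSuitor μ m (μ a)) (hb : I.IsSuitor μ m (μ b)) : a = b := by
  have h1 := ha.best hS hμ b (hb.spec hS).2
  have h2 := hb.best hS hμ a (ha.spec hS).2
  grind

/-- If the suitor of `m` is the wife of `m'`, and the two wives like opposite ends of the scale,
then the suitor of `m'` is the wife of `m`. -/
theorem IsSuitor.eq_of_opposite (hS : I.IsTwoSided s t q p) (hμ : I.IsStable μ) {a b c : M}
    (hab : I.IsSuitor μ a (μ b)) (hbc : I.IsSuitor μ b (μ c)) (ht : ¬ (t (μ a) ↔ t (μ b))) :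
    c = a := by
  by_contra hca
  have h1 := hab.spec hS
  have h2 := hbc.spec hS
  have h3 := hab.best hS hμ c
  have h4 := hbc.best hS hμ a
  have h5 := hμ.not_blocking hS c b
  have h6 := hμ.not_blocking hS c a
  have h7 := hμ.not_blocking hS b a
  have h8 : q c ≠ q a := fun h => hca (hS.q_inj h)
  have h9 : p (μ c) ≠ p (μ a) := fun h => hca (μ.injective (hS.p_inj h))
  grind

/-- An exposed rotation consists of two couples, each man having the wife of the other as suitor.
The couple whose woman likes high positions is listed first. -/
theorem IsExposed.exists_eq_pair (hS : I.IsTwoSided s t q p) (hμ : I.IsStable μ)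
    {R : Cycle (M × W)} (hR : I.IsExposed μ R) :
    ∃ l h, R = ([(l, μ l), (h, μ h)] : List (M × W)) ∧ t (μ l) ∧ ¬ t (μ h) ∧
      I.IsSuitor μ l (μ h) ∧ I.IsSuitor μ h (μ l) := by
  obtain ⟨hne, hnd, hmem, hch⟩ := hR
  have hch' := cycle_chain_and_mem hch
  -- Along the rotation the taste of the women has to change somewhere.
  obtain ⟨A, hA, B, hB, hAB, hop⟩ : ∃ A ∈ R, ∃ B ∈ R, I.IsSuitor μ A.1 B.2 ∧
      ¬ (t A.2 ↔ t B.2) := by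
    by_contra! hcon
    let r : M × W → M × W → Prop := fun A B => (t A.2 ↔ t B.2) ∧
      ((t A.2 ∧ q B.1 < q A.1) ∨ (¬ t A.2 ∧ q A.1 < q B.1))
    have : IsTrans (M × W) r := ⟨fun A B C hAB hBC => by grind⟩
    have : Std.Irrefl r := ⟨fun A => by grind⟩
    refine hne (Cycle.Chain.eq_nil_of_irrefl (r := r) (hch'.imp ?_))
    rintro A B ⟨hs, hA, hB⟩
    have h1 := hcon A hA B hB hs
    rw [← hmem B hB] at hs
    have h2 := (hs.spec hS).2
    rw [hmem B hB] at h2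
    exact ⟨h1, by grind⟩
  obtain ⟨c, rfl⟩ := exists_cons_of_mem_cycle hA
  have e1 : ∀ C ∈ (↑(A :: c) : Cycle (M × W)), C = (C.1, μ C.1) := fun C hC => by
    rw [hmem C hC]
  rw [e1 A hA, e1 B hB] at hop
  rw [e1 B hB] at hAB
  suffices h : c = [B] ∧ I.IsSuitor μ B.1 (μ A.1) by
    rw [h.1]
    by_cases ht : t (μ A.1)
    · exact ⟨A.1, B.1, by rw [← e1 A hA, ← e1 B hB], ht, by tauto, hAB, h.2⟩
    · refine ⟨B.1, A.1, ?_, by tauto, ht, h.2, hAB⟩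
      rw [← e1 A hA, ← e1 B hB, Cycle.coe_eq_coe]
      exact List.isRotated_append (l := [A]) (l' := [B])
  rw [Cycle.chain_coe_cons] at hch
  match c, hmem, hch, hnd, e1 with
  | [], hmem, hch, _, _ =>
    have h1 : I.IsSuitor μ A.1 A.2 := by simpa using hch
    rw [← hmem A (by simp)] at h1
    have := (h1.spec hS).1
    grind
  | [B'], hmem, hch, _, e1 =>
    have h1 : I.IsSuitor μ A.1 B'.2 ∧ I.IsSuitor μ B'.1 A.2 := by simpa using hch
    rw [← hmem A (by simp), ← hmem B' (by simp)] at h1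
    have h2 := h1.1.unique hS hμ hAB
    have h3 : B' = B := by rw [e1 B' (by simp), e1 B hB, h2]
    subst h3
    exact ⟨rfl, h1.2⟩
  | B' :: C :: c', hmem, hch, hnd, e1 =>
    have h1 : I.IsSuitor μ A.1 B'.2 ∧ I.IsSuitor μ B'.1 C.2 := by
      simp only [List.cons_append, List.isChain_cons_cons] at hch
      exact ⟨hch.1, hch.2.1⟩
    rw [← hmem B' (by simp), ← hmem C (by simp)] at h1
    have h2 := h1.1.unique hS hμ hAB
    rw [h2] at h1
    have h3 := hAB.eq_of_opposite hS hμ h1.2 hop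
    have h4 : C = A := by rw [e1 C (by simp), e1 A hA, h3]
    simp [h4] at hnd

end Stable

/-! ### Distinct rotations are nested -/

section Nested

variable {I : SMInstance M W} {s : M → Prop} {t : W → Prop} {q : M → ℝ} {p : W → ℝ} {μ : M ≃ W}

theorem card_filter_eq_add_one {X : Type*} [Fintype X] {P Q : X → Prop} [DecidablePred P]
    [DecidablePred Q] {x : X} (h : ∀ z, Q z ↔ P z ∨ z = x) (hx : ¬ P x) :
    Finset.card {z | Q z} = Finset.card {z | P z} + 1 := by
  classical
  rw [← Finset.card_insert_of_notMem (s := {z | P z}) (a := x) (by simpa using hx)]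
  congr 1
  ext z
  simp [h, or_comm]

open Classical in
/-- The combinatorial data of a rotation `R` of two men `a`, `b` with `s a`, `¬ s b` and two women
`u`, `v` with `t u`, `¬ t v`. The cardinality fields tie the ranks of the four persons, each taken
among the persons of the same sex and taste, to one another. In `cross`, the first alternative is
that `R` separates couples of equal taste, the second that it creates them. -/
structure IsSwap [Fintype M] [Fintype W] (s : M → Prop) (t : W → Prop) (q : M → ℝ) (p : W → ℝ)
    (R : Cycle (M × W)) (a b : M) (u v : W) : Prop where
  ha : s a
  hb : ¬ s b
  hu : t u
  hv : ¬ t v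
  card_u : Finset.card {w | t w ∧ p u ≤ p w} = Finset.card {m | s m ∧ q a ≤ q m}
  card_v : Finset.card {w | ¬ t w ∧ p w ≤ p v} = Finset.card {m | ¬ s m ∧ q m ≤ q b}
  card_b : Finset.card {m | ¬ s m ∧ q m ≤ q b} + Finset.card {w | t w} =
    Finset.card {m | s m ∧ q a ≤ q m} + Finset.card {m | ¬ s m}
  cross : (q a < q b ∧ p v < p u ∧ R = ([(a, u), (b, v)] : List (M × W))) ∨
    (q b < q a ∧ p u < p v ∧ R = ([(b, u), (a, v)] : List (M × W)))

/-- In both orientations of a rotation, stability and the choice of suitors show that each set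
counted in `IsSwap` is a class of couples of the matching, up to the swapping persons themselves;
the classes are counted by `c1`, `c2` and `c3`. -/
theorem IsExposed.exists_isSwap [Fintype M] [Fintype W] (hS : I.IsTwoSided s t q p)
    (hμ : I.IsStable μ) {R : Cycle (M × W)} (hR : I.IsExposed μ R) :
    ∃ a b u v, IsSwap s t q p R a b u v := by
  classical
  obtain ⟨l, h, rfl, hl, hh, hlh, hhl⟩ := hR.exists_eq_pair hS hμ
  have h1 := hlh.spec hS
  have h2 := hhl.spec hS
  have hst := fun m m' => hμ.not_blocking hS m m'
  have hbl := fun x => hlh.best hS hμ x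
  have hbh := fun x => hhl.best hS hμ x
  have hq : ∀ m m', q m = q m' → m = m' := fun m m' h => hS.q_inj h
  have hp : ∀ m m', p (μ m) = p (μ m') → m = m' := fun m m' h => μ.injective (hS.p_inj h)
  have c1 : Finset.card {w | t w ∧ s (μ.symm w)} = Finset.card {m | s m ∧ t (μ m)} :=
    Finset.card_equiv μ.symm (by simp [and_comm])
  have c2 : Finset.card {w | ¬ t w ∧ ¬ s (μ.symm w)} = Finset.card {m | ¬ s m ∧ ¬ t (μ m)} :=
    Finset.card_equiv μ.symm (by simp [and_comm])
  have c3 : Finset.card {m | ¬ s m ∧ ¬ t (μ m)} + Finset.card {w | t w} =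
      Finset.card {m | s m ∧ t (μ m)} + Finset.card {m | ¬ s m} := by
    have d1 : Finset.card {w | t w} = Finset.card {m | t (μ m)} :=
      Finset.card_equiv μ.symm (by simp)
    have d2 := Finset.card_filter_add_card_filter_not (s := ({m | t (μ m)} : Finset M)) s
    have d3 := Finset.card_filter_add_card_filter_not (s := ({m | ¬ s m} : Finset M))
      (fun m => t (μ m))
    simp only [Finset.filter_filter] at d2 d3
    simp only [and_comm] at d2 d3 ⊢
    omega
  by_cases hs : s l
  · have hs' : ¬ s h := by grind
    have e1 : ∀ m, (s m ∧ q l ≤ q m) ↔ s m ∧ t (μ m) := by grind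
    have e2 : ∀ m, (¬ s m ∧ q m ≤ q h) ↔ ¬ s m ∧ ¬ t (μ m) := by grind
    have e3 : ∀ m, (t (μ m) ∧ p (μ l) ≤ p (μ m)) ↔ t (μ m) ∧ s m := by grind
    have e4 : ∀ m, (¬ t (μ m) ∧ p (μ m) ≤ p (μ h)) ↔ ¬ t (μ m) ∧ ¬ s m := by grind
    have e3' := fun w => e3 (μ.symm w)
    have e4' := fun w => e4 (μ.symm w)
    simp only [Equiv.apply_symm_apply] at e3' e4'
    refine ⟨l, h, μ l, μ h, hs, hs', hl, hh, ?_, ?_, ?_, Or.inl ⟨by grind, by grind, rfl⟩⟩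
    all_goals simp only [e1, e2, e3', e4']
    exacts [c1, c2, c3]
  · have hs' : s h := by grind
    -- Here the persons of each couple have opposite tastes, so they lie just outside the classes
    -- of couples of equal taste and add one to each count.
    have e1 : ∀ m, (s m ∧ q h ≤ q m) ↔ (s m ∧ t (μ m)) ∨ m = h := by grind
    have e2 : ∀ m, (¬ s m ∧ q m ≤ q l) ↔ (¬ s m ∧ ¬ t (μ m)) ∨ m = l := by grind
    have e3 : ∀ m, (t (μ m) ∧ p (μ l) ≤ p (μ m)) ↔ (t (μ m) ∧ s m) ∨ m = l := by grind
    have e4 : ∀ m, (¬ t (μ m) ∧ p (μ m) ≤ p (μ h)) ↔ (¬ t (μ m) ∧ ¬ s m) ∨ m = h := by grind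
    have e3' := fun w => e3 (μ.symm w)
    have e4' := fun w => e4 (μ.symm w)
    simp only [Equiv.apply_symm_apply, Equiv.symm_apply_eq] at e3' e4'
    have f1 := card_filter_eq_add_one e1 (by tauto)
    have f2 := card_filter_eq_add_one e2 (by tauto)
    have f3 := card_filter_eq_add_one e3' (by simp [hs])
    have f4 := card_filter_eq_add_one e4' (by simp [hs'])
    exact ⟨h, l, μ l, μ h, hs', hs, hl, hh, by omega, by omega, by omega,
      Or.inr ⟨by grind, by grind, rfl⟩⟩

theorem card_filter_le_lt_iff {X : Type*} [Fintype X] {P : X → Prop} {f : X → ℝ}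
    [DecidablePred P] {x y : X} (hy : P y) :
    Finset.card {z | P z ∧ f z ≤ f x} < Finset.card {z | P z ∧ f z ≤ f y} ↔ f x < f y := by
  constructor
  · contrapose!
    intro h
    refine Finset.card_le_card fun z => ?_
    simp only [Finset.mem_filter_univ]
    exact fun hz => ⟨hz.1, hz.2.trans h⟩
  · intro h
    refine Finset.card_lt_card ⟨fun z => ?_, fun h' => ?_⟩
    · simp only [Finset.mem_filter_univ]
      exact fun hz => ⟨hz.1, hz.2.trans h.le⟩
    · have := @h' y (by simpa using hy)
      simp only [Finset.mem_filter_univ] at this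
      linarith [this.2]

theorem card_filter_ge_lt_iff {X : Type*} [Fintype X] {P : X → Prop} {f : X → ℝ}
    [DecidablePred P] {x y : X} (hy : P y) :
    Finset.card {z | P z ∧ f x ≤ f z} < Finset.card {z | P z ∧ f y ≤ f z} ↔ f y < f x := by
  simpa using card_filter_le_lt_iff (f := fun z => -f z) (x := x) hy

/-- The shape of a rotation, in a form that does not depend on who of the men likes high positions:
`l` and `h` are the men with `q l < q h`. -/
structure IsPair (s : M → Prop) (t : W → Prop) (q : M → ℝ) (p : W → ℝ)
    (R : Cycle (M × W)) (l h : M) (u v : W) : Prop where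
  eq : R = ([(l, u), (h, v)] : List (M × W))
  hu : t u
  hv : ¬ t v
  lt : q l < q h
  cross : (s l ∧ ¬ s h ∧ p v < p u) ∨ (¬ s l ∧ s h ∧ p u < p v)

/-- The interval spanned by the men `l'`, `h'` of a rotation lies strictly inside the one spanned by
the men `l`, `h` of another, and the intervals of the women are nested the other way around. -/
structure Nested (s : M → Prop) (q : M → ℝ) (p : W → ℝ) (l h : M) (u v : W) (l' h' : M)
    (u' v' : W) : Prop where
  l_lt : q l < q l'
  lt_h : q h' < q h
  same : s l ↔ s l'
  women : (s l ∧ p v' < p v ∧ p u < p u') ∨ (¬ s l ∧ p v < p v' ∧ p u' < p u)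

theorem IsSwap.exists_isPair [Fintype M] [Fintype W] {R : Cycle (M × W)} {a b : M} {u v : W}
    (h : IsSwap s t q p R a b u v) :
    (q a < q b ∧ p v < p u ∧ IsPair s t q p R a b u v) ∨
      (q b < q a ∧ p u < p v ∧ IsPair s t q p R b a u v) := by
  have ha := h.ha
  have hb := h.hb
  refine h.cross.imp (fun c => ⟨c.1, c.2.1, c.2.2, h.hu, h.hv, c.1, ?_⟩)
    (fun c => ⟨c.1, c.2.1, c.2.2, h.hu, h.hv, c.1, ?_⟩) <;> tauto

/-- Comparing the numbers in `IsSwap` shows that the four scales are traversed in parallel. -/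
theorem IsSwap.lt_iff [Fintype M] [Fintype W]
    {R R' : Cycle (M × W)} {a b a' b' : M} {u v u' v' : W}
    (h : IsSwap s t q p R a b u v) (h' : IsSwap s t q p R' a' b' u' v') :
    (q b < q b' ↔ q a' < q a) ∧ (p u' < p u ↔ q a' < q a) ∧ (p v < p v' ↔ q a' < q a) := by
  classical
  have h1 := card_filter_ge_lt_iff (P := s) (f := q) (x := a) h'.ha
  have h2 := card_filter_le_lt_iff (P := fun m => ¬ s m) (f := q) (x := b) h'.hb
  have h3 := card_filter_ge_lt_iff (P := t) (f := p) (x := u) h'.hu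
  have h4 := card_filter_le_lt_iff (P := fun w => ¬ t w) (f := p) (x := v) h'.hv
  have c1 := h.card_u
  have c2 := h.card_v
  have c3 := h.card_b
  have c1' := h'.card_u
  have c2' := h'.card_v
  have c3' := h'.card_b
  rw [← h1, ← h2, ← h3, ← h4]
  refine ⟨?_, ?_, ?_⟩ <;> constructor <;> intro hlt <;> convert (?_ : _ < _) using 0 <;> omega

theorem IsSwap.nested_or_of_lt [Fintype M] [Fintype W]
    {R R' : Cycle (M × W)} {a b a' b' : M} {u v u' v' : W}
    (hR : IsSwap s t q p R a b u v) (hR' : IsSwap s t q p R' a' b' u' v') (hlt : q a' < q a) :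
    ∃ l h l' h', IsPair s t q p R l h u v ∧ IsPair s t q p R' l' h' u' v' ∧
      (Nested s q p l h u v l' h' u' v' ∨ Nested s q p l' h' u' v' l h u v) := by
  have k1 := hR.ha
  have k2 := hR.hb
  have k3 := hR'.ha
  have k4 := hR'.hb
  obtain ⟨i1, i2, i3⟩ := hR.lt_iff hR'
  have := i1.2 hlt
  have := i2.2 hlt
  have := i3.2 hlt
  -- The two mixed cases are contradictory: in all rotations the lower man has the same taste.
  rcases hR.exists_isPair with ⟨c1, c2, P⟩ | ⟨c1, c2, P⟩ <;>
  rcases hR'.exists_isPair with ⟨c1', c2', P'⟩ | ⟨c1', c2', P'⟩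
  · exact ⟨_, _, _, _, P, P', Or.inr ⟨by grind, by grind, by grind, by grind⟩⟩
  · linarith
  · linarith
  · exact ⟨_, _, _, _, P, P', Or.inl ⟨by grind, by grind, by grind, by grind⟩⟩

theorem IsSwap.eq_of_eq [Fintype M] [Fintype W] (hS : I.IsTwoSided s t q p)
    {R R' : Cycle (M × W)} {a b b' : M} {u v u' v' : W}
    (hR : IsSwap s t q p R a b u v) (hR' : IsSwap s t q p R' a b' u' v') : R = R' := by
  obtain ⟨i1, i2, i3⟩ := hR.lt_iff hR'
  obtain ⟨j1, j2, j3⟩ := hR'.lt_iff hR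
  simp only [lt_irrefl, iff_false, not_lt] at i1 i2 i3 j1 j2 j3
  have e2 := hS.q_inj (le_antisymm j1 i1)
  have e3 := hS.p_inj (le_antisymm i2 j2)
  have e4 := hS.p_inj (le_antisymm j3 i3)
  subst e2 e3 e4
  rcases hR.cross with ⟨c, -, e⟩ | ⟨c, -, e⟩ <;> rcases hR'.cross with ⟨c', -, e'⟩ | ⟨c', -, e'⟩
  exacts [e.trans e'.symm, (c.not_gt c').elim, (c.not_gt c').elim, e.trans e'.symm]

theorem IsPair.mem_iff {R : Cycle (M × W)} {l h : M} {u v : W} (H : IsPair s t q p R l h u v)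
    (x : M × W) : x ∈ R ↔ x = (l, u) ∨ x = (h, v) := by
  rw [H.eq]
  simp

theorem IsPair.unique {R : Cycle (M × W)} {l h l' h' : M} {u v u' v' : W}
    (H : IsPair s t q p R l h u v) (H' : IsPair s t q p R l' h' u' v') :
    l = l' ∧ h = h' ∧ u = u' ∧ v = v' := by
  have h1 := (H'.mem_iff _).1 ((H.mem_iff (l, u)).2 (Or.inl rfl))
  have h2 := (H'.mem_iff _).1 ((H.mem_iff (h, v)).2 (Or.inr rfl))
  have := H.hu
  have := H.hv
  have := H'.hu
  have := H'.hv
  simp only [Prod.mk.injEq] at h1 h2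
  grind

theorem Rotation.exists_isPair [Fintype M] [Fintype W] (hS : I.IsTwoSided s t q p)
    (R : I.Rotation) : ∃ l h u v, IsPair s t q p R.1 l h u v := by
  obtain ⟨μ, hμ, hR⟩ := R.2
  obtain ⟨a, b, u, v, h⟩ := hR.exists_isSwap hS hμ
  rcases h.exists_isPair with h | h
  exacts [⟨_, _, _, _, h.2.2⟩, ⟨_, _, _, _, h.2.2⟩]

/-- Any two distinct rotations are nested. -/
theorem Rotation.nested_or [Fintype M] [Fintype W] (hS : I.IsTwoSided s t q p)
    {R R' : I.Rotation} {l h l' h' : M} {u v u' v' : W} (H : IsPair s t q p R.1 l h u v)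
    (H' : IsPair s t q p R'.1 l' h' u' v') (hne : R ≠ R') :
    Nested s q p l h u v l' h' u' v' ∨ Nested s q p l' h' u' v' l h u v := by
  obtain ⟨μ, hμ, hR⟩ := R.2
  obtain ⟨a, b, x, y, K⟩ := hR.exists_isSwap hS hμ
  obtain ⟨μ', hμ', hR'⟩ := R'.2
  obtain ⟨a', b', x', y', K'⟩ := hR'.exists_isSwap hS hμ'
  have hqa : q a ≠ q a' := by
    intro hq
    obtain rfl := hS.q_inj hq
    exact hne (Subtype.ext (K.eq_of_eq hS K'))
  rcases lt_or_gt_of_ne hqa with hlt | hlt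
  · obtain ⟨_, _, _, _, P', P, N⟩ := K'.nested_or_of_lt K hlt
    obtain ⟨rfl, rfl, rfl, rfl⟩ := H.unique P
    obtain ⟨rfl, rfl, rfl, rfl⟩ := H'.unique P'
    exact N.symm
  · obtain ⟨_, _, _, _, P, P', N⟩ := K.nested_or_of_lt K' hlt
    obtain ⟨rfl, rfl, rfl, rfl⟩ := H.unique P
    obtain ⟨rfl, rfl, rfl, rfl⟩ := H'.unique P'
    exact N

/-! ### Explicit precedence -/

variable [DecidableEq M] [DecidableEq W]

theorem IsPair.isNext_iff {R : I.Rotation} {l h : M} {u v : W}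
    (H : IsPair s t q p R.1 l h u v) (x y : M × W) :
    R.IsNext x y ↔ (x = (l, u) ∧ y = (h, v)) ∨ (x = (h, v) ∧ y = (l, u)) := by
  have hne : (h, v) ≠ (l, u) := fun e => by
    obtain ⟨-, rfl⟩ := Prod.mk.inj e
    exact H.hv H.hu
  obtain ⟨R, hR⟩ := R
  obtain rfl : R = _ := H.eq
  have e1 : ∀ hn hm, Cycle.next (↑[(l, u), (h, v)] : Cycle (M × W)) hn (l, u) hm = (h, v) :=
    fun hn hm => List.next_cons_cons_eq _ _ _ hm
  have e2 : ∀ hn hm, Cycle.next (↑[(l, u), (h, v)] : Cycle (M × W)) hn (h, v) hm = (l, u) :=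
    fun hn hm => List.next_cons_concat (l := []) (y := (l, u)) (hy := hne) (hx := by simp) (h := hm)
  constructor
  · rintro ⟨hx, rfl⟩
    rcases (H.mem_iff x).1 hx with rfl | rfl
    · exact Or.inl ⟨rfl, e1 _ _⟩
    · exact Or.inr ⟨rfl, e2 _ _⟩
  · rintro (⟨rfl, rfl⟩ | ⟨rfl, rfl⟩)
    · exact ⟨(H.mem_iff _).2 (Or.inl rfl), e1 _ _⟩
    · exact ⟨(H.mem_iff _).2 (Or.inr rfl), e2 _ _⟩

theorem IsPair.movesManTo_iff {R : I.Rotation} {l h : M} {u v : W}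
    (H : IsPair s t q p R.1 l h u v) (m : M) (w : W) :
    R.MovesManTo m w ↔ (m = l ∧ w = v) ∨ (m = h ∧ w = u) := by
  simp only [Rotation.MovesManTo, H.isNext_iff]
  constructor
  · rintro ⟨x, y, ⟨rfl, rfl⟩ | ⟨rfl, rfl⟩, rfl, rfl⟩ <;> simp
  · rintro (⟨rfl, rfl⟩ | ⟨rfl, rfl⟩)
    exacts [⟨_, _, Or.inl ⟨rfl, rfl⟩, rfl, rfl⟩, ⟨_, _, Or.inr ⟨rfl, rfl⟩, rfl, rfl⟩]

theorem IsPair.eliminates_iff (hS : I.IsTwoSided s t q p) {R : I.Rotation} {l h : M} {u v : W}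
    (H : IsPair s t q p R.1 l h u v) (m : M) (w : W) :
    R.Eliminates m w ↔ (w = u ∧ q l ≤ q m ∧ q m < q h) ∨ (w = v ∧ q l < q m ∧ q m ≤ q h) := by
  have hu := H.hu
  have hv := H.hv
  have hlt := H.lt
  have hl : q l = q m ↔ l = m := hS.q_inj.eq_iff
  have hh : q h = q m ↔ h = m := hS.q_inj.eq_iff
  have hM : ∀ m₀ m₁, R.MovesWoman w m₀ m₁ ↔
      (w = u ∧ m₀ = l ∧ m₁ = h) ∨ (w = v ∧ m₀ = h ∧ m₁ = l) := by
    intro m₀ m₁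
    simp only [Rotation.MovesWoman, H.isNext_iff]
    constructor
    · rintro ⟨x, y, ⟨rfl, rfl⟩ | ⟨rfl, h2⟩, h3, rfl⟩ <;> grind
    · rintro (⟨rfl, rfl, rfl⟩ | ⟨rfl, rfl, rfl⟩)
      exacts [⟨_, _, Or.inr ⟨rfl, rfl⟩, rfl, rfl⟩, ⟨_, _, Or.inl ⟨rfl, rfl⟩, rfl, rfl⟩]
  simp only [Rotation.Eliminates, hM, hS.woman]
  constructor
  · rintro ⟨m₀, m₁, h1, h2, h3⟩
    grind
  · rintro (⟨rfl, h1, h2⟩ | ⟨rfl, h1, h2⟩)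
    · exact ⟨l, h, by grind⟩
    · exact ⟨h, l, by grind⟩

/-- The outer one of two nested rotations explicitly precedes the inner one: it eliminates the
pair of `l'` and the woman `v` or `h'` and `u`. -/
theorem Nested.explicitlyPrecedes (hS : I.IsTwoSided s t q p) {R R' : I.Rotation}
    {l h l' h' : M} {u v u' v' : W} (H : IsPair s t q p R.1 l h u v)
    (H' : IsPair s t q p R'.1 l' h' u' v') (N : Nested s q p l h u v l' h' u' v') :
    R.ExplicitlyPrecedes R' := by
  obtain ⟨n1, n2, n3, n4⟩ := N
  have := H'.lt
  refine ⟨?_, l', v, v', ?_, ?_, ?_⟩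
  · rintro rfl
    obtain ⟨rfl, -⟩ := H.unique H'
    exact n1.false
  · rw [H.eliminates_iff hS]
    exact Or.inr ⟨rfl, n1, by linarith⟩
  · rw [H'.movesManTo_iff]
    exact Or.inl ⟨rfl, rfl⟩
  · rw [hS.man]
    grind

/-- The inner rotation eliminates only pairs whose man lies in its interval, and the outer one moves
no such man. -/
theorem Nested.not_explicitlyPrecedes (hS : I.IsTwoSided s t q p) {R R' : I.Rotation}
    {l h l' h' : M} {u v u' v' : W} (H : IsPair s t q p R.1 l h u v)
    (H' : IsPair s t q p R'.1 l' h' u' v') (N : Nested s q p l h u v l' h' u' v') :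
    ¬ R'.ExplicitlyPrecedes R := by
  obtain ⟨n1, n2, n3, n4⟩ := N
  have := H'.lt
  rintro ⟨-, m, w, w', h1, h2, -⟩
  rw [H'.eliminates_iff hS] at h1
  rw [H.movesManTo_iff] at h2
  grind

theorem Rotation.explicitlyPrecedes_iff [Fintype M] [Fintype W] (hS : I.IsTwoSided s t q p)
    {R R' : I.Rotation} {l h l' h' : M} {u v u' v' : W} (H : IsPair s t q p R.1 l h u v)
    (H' : IsPair s t q p R'.1 l' h' u' v') : R.ExplicitlyPrecedes R' ↔ q l < q l' := by
  by_cases hne : R = R'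
  · subst hne
    obtain ⟨rfl, -⟩ := H.unique H'
    simp [Rotation.ExplicitlyPrecedes]
  · rcases Rotation.nested_or hS H H' hne with N | N
    · exact iff_of_true (N.explicitlyPrecedes hS H H') N.l_lt
    · exact iff_of_false (N.not_explicitlyPrecedes hS H' H) N.l_lt.not_gt

end Nested

/-! ### The chain of rotations -/

/-- A finite preorder that is the pullback of the reals along an injective map is a chain. -/
theorem exists_orderIso_fin {X : Type*} [Preorder X] [Finite X] {f : X → ℝ}
    (hf : Function.Injective f) (hle : ∀ x y, x ≤ y ↔ f x ≤ f y) :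
    ∃ k : ℕ, Nonempty (X ≃o Fin k) := by
  classical
  have := Fintype.ofFinite X
  let e : X ≃ (Finset.univ.image f : Finset ℝ) :=
    (Equiv.ofInjective f hf).trans (Equiv.setCongr (by simp))
  let e' : X ≃o (Finset.univ.image f : Finset ℝ) := ⟨e, fun {x y} => (hle x y).symm⟩
  exact ⟨_, ⟨e'.trans ((Finset.univ.image f).orderIsoOfFin rfl).symm⟩⟩

/-- An order isomorphism is an isomorphism of Hasse diagrams. -/
def hasseIso {X Y : Type*} [Preorder X] [Preorder Y] (e : X ≃o Y) :
    SimpleGraph.hasse X ≃g SimpleGraph.hasse Y :=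
  ⟨e.toEquiv, by simp [SimpleGraph.hasse_adj]⟩

end SMInstance

open SMInstance in
theorem mainTheorem3 {M W : Type*} [Fintype M] [Fintype W] [DecidableEq M] [DecidableEq W]
    (hcard : Fintype.card M = Fintype.card W)
    (I : SMInstance M W) (hI : I.IsAttribute 1) :
    (∃ k : ℕ, Nonempty (I.Rotation ≃o Fin k) ∧
      Nonempty (SimpleGraph.hasse I.Rotation ≃g SimpleGraph.pathGraph k)) ∧
    (∀ R : I.Rotation, R.size = 2) ∧
    (∀ (m : M) (R R' : I.Rotation), R.HasMan m → R'.HasMan m → R = R') ∧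
    (∀ (w : W) (R R' : I.Rotation), R.HasWoman w → R'.HasWoman w → R = R') ∧
    (∀ R R' : I.Rotation, R ≠ R' → R.ExplicitlyPrecedes R' ∨ R'.ExplicitlyPrecedes R) := by
  obtain ⟨s, t, q, p, hS⟩ := hI.exists_isTwoSided hcard
  choose l h u v H using fun R : I.Rotation => R.exists_isPair hS
  have hnest := fun R R' : I.Rotation => Rotation.nested_or hS (H R) (H R')
  have hprec := fun R R' : I.Rotation => Rotation.explicitlyPrecedes_iff hS (H R) (H R')
  have hinj : Function.Injective fun R => q (l R) := by
    intro R R' hq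
    by_contra hne
    rcases hnest R R' hne with N | N
    exacts [N.l_lt.ne hq, N.l_lt.ne' hq]
  refine ⟨?_, fun R => ?_, fun m R R' hm hm' => ?_, fun w R R' hw hw' => ?_, fun R R' hne => ?_⟩
  · have : Finite I.Rotation := Finite.of_injective l (Function.Injective.of_comp hinj)
    have hle : ∀ R R' : I.Rotation, R ≤ R' ↔ q (l R) ≤ q (l R') := by
      intro R R'
      constructor
      · intro hR
        induction hR with
        | refl => exact le_rfl
        | tail _ h1 ih => exact ih.trans ((hprec _ _).1 h1).le
      · intro hR
        rcases hR.lt_or_eq with hR | hR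
        · exact Relation.ReflTransGen.single ((hprec _ _).2 hR)
        · rw [hinj hR]
    obtain ⟨k, ⟨e⟩⟩ := exists_orderIso_fin hinj hle
    exact ⟨k, ⟨e⟩, ⟨hasseIso e⟩⟩
  · rw [Rotation.size, (H R).eq]
    rfl
  · obtain ⟨w, hw⟩ := hm
    obtain ⟨w', hw'⟩ := hm'
    rw [(H R).mem_iff] at hw
    rw [(H R').mem_iff] at hw'
    have := (H R).lt
    have := (H R').lt
    by_contra hne
    rcases hnest R R' hne with ⟨_, _, -, -⟩ | ⟨_, _, -, -⟩ <;> grind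
  · obtain ⟨m, hm⟩ := hw
    obtain ⟨m', hm'⟩ := hw'
    rw [(H R).mem_iff] at hm
    rw [(H R').mem_iff] at hm'
    have := (H R).hu
    have := (H R').hu
    have := (H R).hv
    have := (H R').hv
    by_contra hne
    rcases hnest R R' hne with ⟨-, -, -, _⟩ | ⟨-, -, -, _⟩ <;> grind
  · exact (hnest R R' hne).imp (fun N => (hprec _ _).2 N.l_lt) (fun N => (hprec _ _).2 N.l_lt)
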